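/- Let $n\in\mathbb N$, $n\ge 1$, $Y=(0,1)^n$, and let $A\in L^\infty_{\mathrm{per}}(Y;\mathbb R^{n\times n}_{\mathrm{sym}})$ and $b\in L^\infty_{\mathrm{per}}(Y;\mathbb R^n)$ be $Y$-periodic with $\lambda I_n\le A\le\Lambda I_n$ a.e. for some $\lambda,\Lambda>0$. Suppose that for some $\delta\in\left(\frac{n}{n+\pi^2},1\right]$ $$\frac{|A|^2+|b|^2}{(\mathrm{tr}\,A)^2}\le\frac1{n-1+\delta}\quad\text{a.e. in }\mathbb R^n,$$ where $|A|$ is the Frobenius norm. Put $\gamma:=\frac{\mathrm{tr}\,A}{|A|^2+|b|^2}$, $\tilde A:=\gamma A$, $\tilde b:=\gamma b$. Let $H^1_{\mathrm{per},0}(Y;\mathbb R^n)$ denote the space of $Y$-periodic $H^1$ vector fields with zero mean over $Y$, and define on it $$B_2(v,w):=\int_Y(\nabla\cdot v)\,(\tilde A:Dw+\tilde b\cdot w)+\frac12\int_Y\left(Dv-(Dv)^{\mathrm T}\right):\left(Dw-(Dw)^{\mathrm T}\right).$$ Then there exist a unique $\tilde r\in L^2_{\mathrm{per}}(Y)$ with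 $\int_Y\tilde r=1$ and $$\int_Y\tilde r\,(\tilde A:D^2\varphi+\tilde b\cdot\nabla\varphi)=0\qquad\forall\varphi\in H^2_{\mathrm{per}}(Y),$$ and a unique $\rho\in H^1_{\mathrm{per},0}(Y;\mathbb R^n)$ with $B_2(\rho,w)=\int_Y(\tilde A:Dw+\tilde b\cdot w)$ for all $w\in H^1_{\mathrm{per},0}(Y;\mathbb R^n)$. Moreover, for every closed linear subspace $P_h$ of $H^1_{\mathrm{per},0}(Y;\mathbb R^n)$ there exists a unique $\rho_h\in P_h$ such that $$B_2(\rho_h,w_h)=\int_Y(\tilde A:Dw_h+\tilde b\cdot w_h)\qquad\forall w_h\in P_h,$$ and, setting $\tilde r_h:=1-\nabla\cdot\rho_h$, there holds $$\|\tilde r-\tilde r_h\|_{L^2(Y)}\le C\inf_{w_h\in P_h}\|D(\rho-w_h)\|_{L^2(Y;\mathbb R^{n\times n})},$$ where $$C:=\frac{1+\frac{\Lambda}{\lambda}\sqrt n\,\sqrt{1+\frac{n}{\pi^2}}}{1-\sqrt{1-\kappa}}>0,\qquad \kappa:=\left(\delta-\frac{n}{n+\pi^2}\right)\frac{n+\pi^2}{\pi^2},$$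 depends only on $\lambda,\Lambda,\delta,n$. -/

import Mathlib

open MeasureTheory
open scoped ENNReal ContDiff

noncomputable section

namespace FPK

/-- The open unit cell `Y = (0,1)^n`. -/
def cell (n : ℕ) : Set (Fin n → ℝ) := Set.univ.pi fun _ => Set.Ioo (0 : ℝ) 1

/-- Lebesgue measure on the unit cell. -/
abbrev cellMeasure (n : ℕ) : Measure (Fin n → ℝ) := volume.restrict (cell n)

/-- Invariance under integer translations (it suffices to ask it for the coordinate directions). -/
def IsCellPeriodic {n : ℕ} {β : Type*} (f : (Fin n → ℝ) → β) : Prop :=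
  ∀ (i : Fin n) (x : Fin n → ℝ), f (x + Pi.single i 1) = f x

/-- The almost everywhere version, which is the one that makes sense for classes of functions. -/
def IsAECellPeriodic {n : ℕ} {β : Type*} (f : (Fin n → ℝ) → β) : Prop :=
  ∀ i : Fin n, ∀ᵐ x : Fin n → ℝ, f (x + Pi.single i 1) = f x

/-- The classical partial derivative `∂φ/∂x_j`. -/
def partialDeriv {n : ℕ} (j : Fin n) (φ : (Fin n → ℝ) → ℝ) (x : Fin n → ℝ) : ℝ :=
  fderiv ℝ φ x (Pi.single j 1)

/-- `L²_per(Y)`: a `Y`-periodic locally square-integrable function on `ℝⁿ` is the same thing as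
its restriction to the unit cell. -/
abbrev L2per (n : ℕ) : Type := Lp ℝ 2 (cellMeasure n)

/-- `g` is the weak partial derivative `∂_j u` of the periodic function `u`: integration by parts
over one period holds against every smooth `Y`-periodic test function.  (Since the test functions
need not vanish on the boundary of the cell, this is the derivative on the torus, that is, the weak
derivative on `ℝⁿ` of the periodic extension of `u`.) -/
def IsWeakPartial {n : ℕ} (j : Fin n) (u g : L2per n) : Prop :=
  ∀ φ : (Fin n → ℝ) → ℝ, ContDiff ℝ ∞ φ → IsCellPeriodic φ →
    ∫ x in cell n, u x * partialDeriv j φ x = - ∫ x in cell n, g x * φ x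

theorem cell_subset_Icc (n : ℕ) : cell n ⊆ Set.Icc (0 : Fin n → ℝ) 1 := fun _ hx =>
  ⟨fun i => (hx i (Set.mem_univ i)).1.le, fun i => (hx i (Set.mem_univ i)).2.le⟩

theorem measurableSet_cell (n : ℕ) : MeasurableSet (cell n) :=
  MeasurableSet.univ_pi fun _ => measurableSet_Ioo

instance isFiniteMeasure_cellMeasure (n : ℕ) : IsFiniteMeasure (cellMeasure n) :=
  isFiniteMeasure_restrict.2
    (((isCompact_Icc (a := (0 : Fin n → ℝ)) (b := 1)).measure_lt_top.trans_le'
      (measure_mono (cell_subset_Icc n))).ne)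

theorem memLp_of_continuous {n : ℕ} {f : (Fin n → ℝ) → ℝ} (hf : Continuous f) :
    MemLp f 2 (cellMeasure n) := by
  obtain ⟨C, hC⟩ := (isCompact_Icc (a := (0 : Fin n → ℝ)) (b := 1)).exists_bound_of_continuousOn
    hf.continuousOn
  refine MemLp.of_bound hf.aestronglyMeasurable C ?_
  filter_upwards [ae_restrict_mem (measurableSet_cell n)] with x hx
  exact hC x (cell_subset_Icc n hx)

theorem integrable_mul_of_continuous {n : ℕ} (u : L2per n) {f : (Fin n → ℝ) → ℝ}
    (hf : Continuous f) : Integrable (fun x => u x * f x) (cellMeasure n) :=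
  (Lp.memLp u).integrable_mul (memLp_of_continuous hf)

theorem continuous_partialDeriv {n : ℕ} (j : Fin n) {φ : (Fin n → ℝ) → ℝ}
    (hφ : ContDiff ℝ ∞ φ) : Continuous (partialDeriv j φ) :=
  (hφ.continuous_fderiv (by simp)).clm_apply continuous_const

theorem integral_add_mul {n : ℕ} (u v : L2per n) {f : (Fin n → ℝ) → ℝ} (hf : Continuous f) :
    ∫ x in cell n, (u + v : L2per n) x * f x
      = (∫ x in cell n, u x * f x) + ∫ x in cell n, v x * f x := by
  rw [← integral_add (integrable_mul_of_continuous u hf) (integrable_mul_of_continuous v hf)]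
  refine integral_congr_ae ?_
  filter_upwards [Lp.coeFn_add u v] with x hx
  rw [hx, Pi.add_apply, add_mul]

theorem integral_smul_mul {n : ℕ} (c : ℝ) (u : L2per n) (f : (Fin n → ℝ) → ℝ) :
    ∫ x in cell n, (c • u : L2per n) x * f x = c * ∫ x in cell n, u x * f x := by
  rw [← integral_const_mul]
  refine integral_congr_ae ?_
  filter_upwards [Lp.coeFn_smul c u] with x hx
  rw [hx, Pi.smul_apply, smul_eq_mul, mul_assoc]

theorem integral_zero_mul {n : ℕ} (f : (Fin n → ℝ) → ℝ) :
    ∫ x in cell n, (0 : L2per n) x * f x = 0 := by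
  have h := integral_smul_mul (0 : ℝ) (0 : L2per n) f
  rwa [zero_smul, zero_mul] at h

theorem IsWeakPartial.zero {n : ℕ} (j : Fin n) : IsWeakPartial j (0 : L2per n) 0 :=
  fun φ _ _ => by rw [integral_zero_mul, integral_zero_mul, neg_zero]

theorem IsWeakPartial.add {n : ℕ} {j : Fin n} {u v g h : L2per n} (hu : IsWeakPartial j u g)
    (hv : IsWeakPartial j v h) : IsWeakPartial j (u + v) (g + h) := fun φ hφ hp => by
  rw [integral_add_mul u v (continuous_partialDeriv j hφ), integral_add_mul g h hφ.continuous,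
    hu φ hφ hp, hv φ hφ hp, neg_add]

theorem IsWeakPartial.smul {n : ℕ} {j : Fin n} {u g : L2per n} (c : ℝ)
    (hu : IsWeakPartial j u g) : IsWeakPartial j (c • u) (c • g) := fun φ hφ hp => by
  rw [integral_smul_mul, integral_smul_mul, hu φ hφ hp, mul_neg]

/-- The Hilbert space `L²_per(Y;ℝⁿ) × L²_per(Y;ℝ^{n×n})` with the norm
`(‖w‖_{L²}² + ‖G‖_{L²}²)^{1/2}`; vectors carry the Euclidean and matrices the Frobenius norm. -/
abbrev L2Pair (n : ℕ) : Type :=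
  WithLp 2 (PiLp 2 (fun _ : Fin n => L2per n) × PiLp 2 (fun _ : Fin n × Fin n => L2per n))

/-- `H¹_{per,0}(Y;ℝⁿ)`: the periodic vector fields `w` of class `H¹` with zero mean over `Y`, each
of them recorded together with its weak Jacobian, `(Dw)_{ij} = ∂_j w_i`, which it determines.  As a
subspace of `L2Pair n` the space carries the `H¹` norm `(‖w‖_{L²}² + ‖Dw‖_{L²}²)^{1/2}`. -/
def H1perZero (n : ℕ) : Submodule ℝ (L2Pair n) where
  carrier := {p | (∀ i, ∫ x in cell n, p.fst i x = 0) ∧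
    ∀ i j, IsWeakPartial j (p.fst i) (p.snd (i, j))}
  zero_mem' := by
    refine ⟨fun i => ?_, fun i j => IsWeakPartial.zero j⟩
    simpa using integral_zero_mul (n := n) (fun _ => 1)
  add_mem' := by
    rintro p q ⟨hp, hp'⟩ ⟨hq, hq'⟩
    refine ⟨fun i => ?_, fun i j => (hp' i j).add (hq' i j)⟩
    have h := integral_add_mul (p.fst i) (q.fst i) (continuous_const (y := (1 : ℝ)))
    simp only [mul_one] at h
    simpa [hp i, hq i] using h
  smul_mem' := by
    rintro c p ⟨hp, hp'⟩
    refine ⟨fun i => ?_, fun i j => (hp' i j).smul c⟩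
    have h := integral_smul_mul c (p.fst i) (fun _ => 1)
    simp only [mul_one] at h
    simpa [hp i] using h

/-- The component `w_i`. -/
def comp {n : ℕ} (w : H1perZero n) (i : Fin n) : L2per n := (w : L2Pair n).fst i

/-- The weak Jacobian `Dw`, in `L²_per(Y;ℝ^{n×n})`; its norm is
`‖Dw‖_{L²} = (∑_{ij} ‖∂_j w_i‖_{L²}²)^{1/2}`. -/
def jac {n : ℕ} (w : H1perZero n) : PiLp 2 (fun _ : Fin n × Fin n => L2per n) :=
  (w : L2Pair n).snd

/-- The divergence `∇·w`. -/
def divg {n : ℕ} (w : H1perZero n) : L2per n := ∑ i, jac w (i, i)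

/-- `φ` belongs to `H²_per(Y)`, with weak gradient `g` and weak Hessian `H`. -/
def IsH2per {n : ℕ} (φ : L2per n) (g : Fin n → L2per n) (H : Fin n → Fin n → L2per n) : Prop :=
  (∀ i, IsWeakPartial i φ (g i)) ∧ ∀ i j, IsWeakPartial j (g i) (H i j)

/-- The squared Frobenius norm `|M|² = M : M`. -/
def frobSq {n : ℕ} (M : Matrix (Fin n) (Fin n) ℝ) : ℝ := ∑ i, ∑ j, M i j ^ 2

/-- The squared Euclidean norm `|v|²`. -/
def euclSq {n : ℕ} (v : Fin n → ℝ) : ℝ := ∑ i, v i ^ 2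

/-- The standing assumptions on the coefficients: `A` and `b` are essentially bounded and
`Y`-periodic, `A` is symmetric with `lam I ≤ A ≤ Lam I`, and the Cordes-type condition holds with
the parameter `δ`.  (`Matrix.PosSemidef` includes symmetry.) -/
structure IsCordes {n : ℕ} (A : (Fin n → ℝ) → Matrix (Fin n) (Fin n) ℝ)
    (b : (Fin n → ℝ) → Fin n → ℝ) (lam Lam δ : ℝ) : Prop where
  memLp_A : ∀ i j, MemLp (fun x => A x i j) ∞ volume
  memLp_b : ∀ i, MemLp (fun x => b x i) ∞ volume
  periodic_A : IsAECellPeriodic A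
  periodic_b : IsAECellPeriodic b
  lam_pos : 0 < lam
  Lam_pos : 0 < Lam
  elliptic : ∀ᵐ x : Fin n → ℝ, (A x - lam • (1 : Matrix (Fin n) (Fin n) ℝ)).PosSemidef ∧
    (Lam • (1 : Matrix (Fin n) (Fin n) ℝ) - A x).PosSemidef
  lt_delta : (n : ℝ) / (n + Real.pi ^ 2) < δ
  delta_le : δ ≤ 1
  cordes : ∀ᵐ x : Fin n → ℝ,
    (frobSq (A x) + euclSq (b x)) / (A x).trace ^ 2 ≤ 1 / ((n : ℝ) - 1 + δ)

section Coefficients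

variable {n : ℕ} (A : (Fin n → ℝ) → Matrix (Fin n) (Fin n) ℝ) (b : (Fin n → ℝ) → Fin n → ℝ)

/-- The renormalization function `γ = tr(A) / (|A|² + |b|²)`. -/
def renorm (x : Fin n → ℝ) : ℝ := (A x).trace / (frobSq (A x) + euclSq (b x))

/-- The renormalized diffusion `Ã = γ A`. -/
def Atil (x : Fin n → ℝ) : Matrix (Fin n) (Fin n) ℝ := renorm A b x • A x

/-- The renormalized drift `b̃ = γ b`. -/
def btil (x : Fin n → ℝ) : Fin n → ℝ := renorm A b x • b x

/-- The function `Ã : M + b̃ · v`, for a matrix field `M` and a vector field `v`. -/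
def ndOp (M : Fin n → Fin n → L2per n) (v : Fin n → L2per n) (x : Fin n → ℝ) : ℝ :=
  (∑ i, ∑ j, Atil A b x i j * M i j x) + ∑ i, btil A b x i * v i x

/-- The bilinear form
`B₂(v,w) = ∫_Y (∇·v)(Ã:Dw + b̃·w) + ½ ∫_Y (Dv - (Dv)ᵀ) : (Dw - (Dw)ᵀ)`. -/
def B2 (v w : H1perZero n) : ℝ :=
  (∫ x in cell n, divg v x * ndOp A b (fun i j => jac w (i, j)) (comp w) x)
    + 1 / 2 * ∫ x in cell n, ∑ i, ∑ j,
        (jac v (i, j) x - jac v (j, i) x) * (jac w (i, j) x - jac w (j, i) x)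

/-- The linear functional `w ↦ ∫_Y (Ã:Dw + b̃·w)`. -/
def loadFun (w : H1perZero n) : ℝ :=
  ∫ x in cell n, ndOp A b (fun i j => jac w (i, j)) (comp w) x

/-- `ρ` solves the Galerkin problem in the subspace `P`: `ρ ∈ P` and
`B₂(ρ,w) = ∫_Y (Ã:Dw + b̃·w)` for all `w ∈ P`. -/
def IsGalerkinSol (P : Submodule ℝ (H1perZero n)) (ρ : H1perZero n) : Prop :=
  ρ ∈ P ∧ ∀ w ∈ P, B2 A b ρ w = loadFun A b w

/-- `r` is a (very weak) `L²_per(Y)` solution of `-D²:(Ã r) + ∇·(b̃ r) = 0` in `Y`, with `r`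
`Y`-periodic and `∫_Y r = 1`: the equation is tested with all `φ ∈ H²_per(Y)`. -/
def IsRenormFPKSol (r : L2per n) : Prop :=
  (∀ (φ : L2per n) (g : Fin n → L2per n) (H : Fin n → Fin n → L2per n), IsH2per φ g H →
    ∫ x in cell n, r x * ndOp A b H g x = 0) ∧
  ∫ x in cell n, r x = 1

end Coefficients

/-- `κ(δ,n) = (δ - n/(n+π²)) (n+π²)/π²`. -/
def kappa (δ : ℝ) (n : ℕ) : ℝ :=
  (δ - (n : ℝ) / (n + Real.pi ^ 2)) * ((n + Real.pi ^ 2) / Real.pi ^ 2)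

/-- The constant in the error bound; it depends only on `λ`, `Λ`, `δ` and `n`. -/
def errConst (lam Lam δ : ℝ) (n : ℕ) : ℝ :=
  (1 + Lam / lam * √(n : ℝ) * √(1 + (n : ℝ) / Real.pi ^ 2)) / (1 - √(1 - kappa δ n))

end FPK

end

/-!
The renormalization `γ` turns the Cordes condition into `|Ã - I|² + |b̃|² ≤ 1 - δ`, so that, by the
Poincaré inequality, `‖Ã : Dw + b̃ · w - ∇ · w‖ ≤ θ ‖Dw‖` with `θ < 1`.  Since
`‖Dw‖² = ‖∇ · w‖² + ½ ‖Dw - (Dw)ᵀ‖²` for periodic fields, `B₂` is a perturbation of the inner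
product of the Jacobians and `B₂(w, w) ≥ (1 - θ) ‖Dw‖²`.  The Lax–Milgram theorem and Céa's lemma
then settle the Galerkin problems.  Testing the problem for `ρ` with gradients, on which the skew
part of `B₂` vanishes, shows that `r̃ = 1 - ∇ · ρ` is a solution.  It is the only one: the
difference of two solutions is `Δφ` for some `φ`, and then `B₂(∇φ, ∇φ) = 0`.  The Poincaré
inequality, the norm identity and the solution of `Δφ = f` are read off Fourier coefficients.
-/

noncomputable section

namespace FPK

open UnitAddTorus ComplexConjugate

attribute [local instance] instMeasureSpaceUnitAddCircle

variable {n : ℕ}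

/-! ### The spaces `L²(μ; ℝ^ι)` -/

section L2

variable {α ι : Type*} [MeasurableSpace α] [Fintype ι] {μ : Measure α}

theorem inner_eq_integral_mul (u v : Lp ℝ 2 μ) : inner ℝ u v = ∫ x, u x * v x ∂μ := by
  simp [L2.inner_def, mul_comm]

theorem inner_toLp_eq_integral_mul (u : Lp ℝ 2 μ) {f : α → ℝ} (hf : MemLp f 2 μ) :
    inner ℝ u hf.toLp = ∫ x, u x * f x ∂μ := by
  rw [inner_eq_integral_mul]
  refine integral_congr_ae ?_
  filter_upwards [hf.coeFn_toLp] with x hx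
  rw [hx]

theorem inner_piLp_eq_integral_sum (f g : PiLp 2 fun _ : ι => Lp ℝ 2 μ) :
    inner ℝ f g = ∫ x, ∑ i, f i x * g i x ∂μ := by
  simp only [PiLp.inner_apply, inner_eq_integral_mul]
  exact (integral_finsetSum _ fun i _ =>
    (Lp.memLp (f i)).integrable_mul (Lp.memLp (g i))).symm

end L2

/-! ### Fourier coefficients of real periodic functions -/

/-- The projection of `ℝⁿ` onto the torus `(ℝ/ℤ)ⁿ`. -/
def toTorus (x : Fin n → ℝ) : UnitAddTorus (Fin n) := fun i => x i

/-- The section of `toTorus` with values in `(0,1]ⁿ`. -/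
def ofTorus (t : UnitAddTorus (Fin n)) : Fin n → ℝ := fun i => AddCircle.equivIoc 1 0 (t i)

theorem toTorus_ofTorus (t : UnitAddTorus (Fin n)) : toTorus (ofTorus t) = t :=
  funext fun _ => AddCircle.coe_equivIoc

theorem continuous_toTorus : Continuous (toTorus (n := n)) :=
  continuous_pi fun i => (AddCircle.continuous_mk' 1).comp (continuous_apply i)

theorem restrict_univ_pi_Ioc (n : ℕ) :
    volume.restrict {x : Fin n → ℝ | ∀ i, x i ∈ Set.Ioc (0 : ℝ) (0 + 1)} = cellMeasure n := by
  have h : {x : Fin n → ℝ | ∀ i, x i ∈ Set.Ioc (0 : ℝ) (0 + 1)}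
      = Set.univ.pi fun _ => Set.Ioc 0 1 := by ext; simp
  rw [h]
  exact Measure.restrict_congr_set
    (Measure.univ_pi_Ioc_ae_eq_Icc.trans Measure.univ_pi_Ioo_ae_eq_Icc.symm)

theorem measurePreserving_ofTorus (n : ℕ) :
    MeasurePreserving (ofTorus (n := n)) volume (cellMeasure n) := by
  rw [← restrict_univ_pi_Ioc]
  exact (measurePreserving_subtype_coe (MeasurableSet.univ_pi' fun _ => measurableSet_Ioc)).comp
    (measurePreserving_equivPiIoc 0)

theorem integral_comp_ofTorus {E : Type*} [NormedAddCommGroup E] [NormedSpace ℝ E]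
    {f : (Fin n → ℝ) → E} (hf : AEStronglyMeasurable f (cellMeasure n)) :
    ∫ t, f (ofTorus t) = ∫ x in cell n, f x := by
  have h := measurePreserving_ofTorus n
  exact (integral_map h.aemeasurable (h.map_eq ▸ hf)).symm.trans (by rw [h.map_eq])

theorem measurePreserving_toTorus (n : ℕ) :
    MeasurePreserving (toTorus (n := n)) (cellMeasure n) volume := by
  refine ⟨continuous_toTorus.measurable, ?_⟩
  rw [← (measurePreserving_ofTorus n).map_eq,
    Measure.map_map continuous_toTorus.measurable (measurePreserving_ofTorus n).measurable,
    funext (f := toTorus ∘ ofTorus) (g := id) toTorus_ofTorus, Measure.map_id]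

/-- The complex function on the torus that a real function on the unit cell represents. -/
def torusL (n : ℕ) : L2per n →L[ℝ] Lp ℂ 2 (volume : Measure (UnitAddTorus (Fin n))) :=
  (Complex.ofRealCLM.compLpL 2 volume).comp
    (Lp.compMeasurePreservingₗᵢ ℝ ofTorus (measurePreserving_ofTorus n)).toContinuousLinearMap

theorem coeFn_torusL (u : L2per n) : torusL n u =ᵐ[volume] fun t => (u (ofTorus t) : ℂ) := by
  refine (Complex.ofRealCLM.coeFn_compLpL _).trans ?_
  filter_upwards [Lp.coeFn_compMeasurePreserving u (measurePreserving_ofTorus n)] with t ht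
  exact congrArg Complex.ofReal ht

theorem inner_torusL (u v : L2per n) :
    inner ℂ (torusL n u) (torusL n v) = (inner ℝ u v : ℝ) := by
  rw [inner_eq_integral_mul, ← integral_comp_ofTorus
    ((Lp.aestronglyMeasurable u).fun_mul (Lp.aestronglyMeasurable v)),
    L2.inner_def, ← integral_complex_ofReal]
  refine integral_congr_ae ?_
  filter_upwards [coeFn_torusL u, coeFn_torusL v] with t hu hv
  rw [hu, hv]
  simp [mul_comm]

/-- The Fourier coefficient `∫_Y u(x) exp(-2πi k·x) dx`, as a functional of `u`. -/
def coef (k : Fin n → ℤ) : L2per n →L[ℝ] ℂ :=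
  ((innerSL ℂ (mFourierLp 2 k)).restrictScalars ℝ).comp (torusL n)

theorem coef_eq_inner (k : Fin n → ℤ) (u : L2per n) :
    coef k u = inner ℂ (mFourierBasis k) (torusL n u) := by
  rw [coe_mFourierBasis]; rfl

theorem coef_eq_mFourierCoeff (k : Fin n → ℤ) (u : L2per n) :
    coef k u = mFourierCoeff (torusL n u) k := by
  rw [coef_eq_inner, ← mFourierBasis.repr_apply_apply, mFourierBasis_repr]

theorem hasSum_conj_coef_mul_coef (u v : L2per n) :
    HasSum (fun k => conj (coef k u) * coef k v) (inner ℝ u v : ℝ) := by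
  rw [← inner_torusL]
  refine (mFourierBasis.hasSum_inner_mul_inner (torusL n u) (torusL n v)).congr_fun fun k => ?_
  rw [coef_eq_inner, coef_eq_inner, inner_conj_symm]

theorem hasSum_norm_coef_sq (u : L2per n) : HasSum (fun k => ‖coef k u‖ ^ 2) (‖u‖ ^ 2) := by
  refine Complex.hasSum_ofReal.1 ?_
  rw [← real_inner_self_eq_norm_sq]
  refine (hasSum_conj_coef_mul_coef u u).congr_fun fun k => ?_
  rw [Complex.conj_mul', Complex.ofReal_pow]

theorem ext_coef {u v : L2per n} (h : ∀ k, coef k u = coef k v) : u = v := by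
  have h0 : HasSum (fun k => ‖coef k (u - v)‖ ^ 2) 0 := by simp [h]
  simpa [sub_eq_zero] using (hasSum_norm_coef_sq (u - v)).unique h0

theorem mFourierCoeff_conj {d : Type*} [Fintype d] (f : UnitAddTorus d → ℂ) (k : d → ℤ) :
    mFourierCoeff (fun t => conj (f t)) k = conj (mFourierCoeff f (-k)) := by
  simp only [mFourierCoeff, ← integral_conj, smul_eq_mul, map_mul, mFourier_neg, neg_neg]

theorem coef_neg (k : Fin n → ℤ) (u : L2per n) : coef (-k) u = conj (coef k u) := by
  have h : mFourierCoeff (torusL n u) (-k)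
      = mFourierCoeff (fun t => conj (torusL n u t)) (-k) := by
    refine integral_congr_ae ?_
    filter_upwards [coeFn_torusL u] with t ht
    simp only [ht, Complex.conj_ofReal]
  rw [coef_eq_mFourierCoeff, coef_eq_mFourierCoeff, h, mFourierCoeff_conj, neg_neg]

theorem ae_conj_eq_self_of_hermitian {d : Type*} [Fintype d]
    {Φ : Lp ℂ 2 (volume : Measure (UnitAddTorus d))}
    (hΦ : ∀ k, mFourierCoeff Φ (-k) = conj (mFourierCoeff Φ k)) :
    ∀ᵐ t, conj (Φ t) = Φ t := by
  have h : star Φ = Φ := by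
    refine mFourierBasis.repr.injective (lp.ext (funext fun k => ?_))
    rw [mFourierBasis_repr, mFourierBasis_repr, ← Complex.conj_conj (mFourierCoeff Φ k), ← hΦ,
      ← mFourierCoeff_conj]
    refine integral_congr_ae ?_
    filter_upwards [Lp.coeFn_star Φ] with t ht
    simp [ht]
  filter_upwards [Lp.coeFn_star Φ] with t ht
  rw [h] at ht
  exact ht.symm

theorem exists_torusL_eq {Φ : Lp ℂ 2 (volume : Measure (UnitAddTorus (Fin n)))}
    (hΦ : ∀ᵐ t, conj (Φ t) = Φ t) : ∃ u, torusL n u = Φ := by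
  have hmem : MemLp (fun x => (Φ (toTorus x)).re) 2 (cellMeasure n) :=
    ((Lp.memLp Φ).comp_measurePreserving (measurePreserving_toTorus n)).re
  refine ⟨hmem.toLp, Lp.ext ((coeFn_torusL _).trans ?_)⟩
  filter_upwards [hΦ, (measurePreserving_ofTorus n).quasiMeasurePreserving.ae_eq_comp
    hmem.coeFn_toLp] with t ht h
  simp only [Function.comp_apply, toTorus_ofTorus] at h
  rw [h, Complex.conj_eq_iff_re.1 ht]

theorem exists_coef_eq {a : (Fin n → ℤ) → ℂ} (ha : Memℓp a 2)
    (hs : ∀ k, a (-k) = conj (a k)) : ∃ u : L2per n, ∀ k, coef k u = a k := by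
  have hΦ (k) : mFourierCoeff (mFourierBasis.repr.symm ⟨a, ha⟩) k = a k := by
    rw [← mFourierBasis_repr, LinearIsometryEquiv.apply_symm_apply]
  obtain ⟨u, hu⟩ := exists_torusL_eq
    (ae_conj_eq_self_of_hermitian fun k => by rw [hΦ, hΦ, hs])
  exact ⟨u, fun k => by rw [coef_eq_mFourierCoeff, hu, hΦ]⟩

theorem exists_coef_eq_mul (s : L2per n) {m : (Fin n → ℤ) → ℂ} {C : ℝ} (hm : ∀ k, ‖m k‖ ≤ C)
    (hs : ∀ k, m (-k) = conj (m k)) : ∃ u : L2per n, ∀ k, coef k u = m k * coef k s := by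
  refine exists_coef_eq (memℓp_gen ?_) fun k => by rw [hs, coef_neg, map_mul]
  refine Summable.of_nonneg_of_le (fun k => by positivity) (fun k => ?_)
    ((hasSum_norm_coef_sq s).summable.mul_left (C ^ 2))
  simp only [ENNReal.toReal_ofNat, Real.rpow_ofNat, norm_mul, mul_pow]
  gcongr
  exact hm k

/-- The phase `x ↦ 2π k·x`. -/
def phase (k : Fin n → ℤ) : (Fin n → ℝ) →L[ℝ] ℝ :=
  ∑ i, (2 * Real.pi * k i) • ContinuousLinearMap.proj i

theorem phase_neg (k : Fin n → ℤ) : phase (-k) = -phase k := by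
  ext; simp [phase]

theorem phase_single (k : Fin n → ℤ) (j : Fin n) : phase k (Pi.single j 1) = 2 * Real.pi * k j := by
  simp [phase, Pi.single_apply]

theorem mFourier_toTorus (k : Fin n → ℤ) (x : Fin n → ℝ) :
    mFourier k (toTorus x) = Real.cos (phase k x) + Real.sin (phase k x) * Complex.I := by
  rw [Complex.ofReal_cos, Complex.ofReal_sin, ← Complex.exp_mul_I]
  simp only [mFourier, toTorus, phase, ContinuousMap.coe_mk, fourier_coe_apply, ← Complex.exp_sum]
  congr 1
  simp only [sum_apply, smul_apply, ContinuousLinearMap.proj_apply, smul_eq_mul,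
    Complex.ofReal_sum, Finset.sum_mul]
  exact Finset.sum_congr rfl fun i _ => by push_cast; ring

theorem coef_eq_integral (k : Fin n → ℤ) (u : L2per n) :
    coef k u = (∫ x in cell n, u x * Real.cos (phase k x) : ℝ)
      - Complex.I * (∫ x in cell n, u x * Real.sin (phase k x) : ℝ) := by
  have hmeas : AEStronglyMeasurable (fun x => mFourier (-k) (toTorus x) * (u x : ℂ))
      (cellMeasure n) :=
    ((mFourier (-k)).continuous.comp continuous_toTorus).aestronglyMeasurable.mul
      (Complex.continuous_ofReal.comp_aestronglyMeasurable (Lp.aestronglyMeasurable u))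
  have hcoef : coef k u = ∫ x in cell n, mFourier (-k) (toTorus x) * (u x : ℂ) := by
    rw [← integral_comp_ofTorus hmeas, coef_eq_mFourierCoeff]
    refine integral_congr_ae ?_
    filter_upwards [coeFn_torusL u] with t ht
    rw [ht, toTorus_ofTorus, smul_eq_mul]
  rw [hcoef, ← integral_complex_ofReal, ← integral_complex_ofReal, ← integral_const_mul,
    ← integral_sub]
  · simp only [mFourier_toTorus, phase_neg, neg_apply, Real.cos_neg,
      Real.sin_neg]
    congr! 2
    push_cast; ring
  · exact (integrable_mul_of_continuous u (Real.continuous_cos.comp (phase k).continuous)).ofReal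
  · exact (integrable_mul_of_continuous u
      (Real.continuous_sin.comp (phase k).continuous)).ofReal.const_mul _

theorem coef_zero (u : L2per n) : coef 0 u = (∫ x in cell n, u x : ℝ) := by
  simp [coef_eq_integral, phase]

/-! ### Weak derivatives in Fourier space -/

theorem IsCellPeriodic.insertNth_one {m : ℕ} {β : Type*} {f : (Fin (m + 1) → ℝ) → β}
    (hf : IsCellPeriodic f) (i : Fin (m + 1)) (x : Fin m → ℝ) :
    f (i.insertNth 1 x) = f (i.insertNth 0 x) := by
  rw [← hf i (i.insertNth 0 x)]
  congr 1
  ext k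
  obtain rfl | ⟨k, rfl⟩ := i.eq_self_or_eq_succAbove k <;> simp

theorem integral_partialDeriv_eq_zero (j : Fin n) {f : (Fin n → ℝ) → ℝ} (hf : ContDiff ℝ 1 f)
    (hp : IsCellPeriodic f) : ∫ x in cell n, partialDeriv j f x = 0 := by
  obtain ⟨m, rfl⟩ : ∃ m, n = m + 1 := ⟨n - 1, (Nat.sub_add_cancel j.pos).symm⟩
  let c : Fin (m + 1) → ℝ := Pi.single j 1
  have hdiv (x : Fin (m + 1) → ℝ) :
      ∑ i, (c i • fderiv ℝ f x) (Pi.single i 1) = partialDeriv j f x := by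
    rw [Fintype.sum_eq_single j fun i hi => by simp [c, hi]]
    simp [c, partialDeriv]
  have hcont : Continuous (partialDeriv j f) :=
    (hf.continuous_fderiv one_ne_zero).clm_apply continuous_const
  have h := integral_divergence_of_hasFDerivAt_off_countable' (0 : Fin (m + 1) → ℝ) 1
    zero_le_one (fun i x => c i • f x) (fun i x => c i • fderiv ℝ f x) ∅ Set.countable_empty
    (fun i => (hf.continuous.const_smul (c i)).continuousOn)
    (fun x _ i => ((hf.differentiable one_ne_zero x).hasFDerivAt).const_smul (c i))
    (by simpa only [hdiv] using hcont.integrableOn_Icc)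
  have hcell : cell (m + 1) =ᵐ[volume] Set.Icc (0 : Fin (m + 1) → ℝ) 1 :=
    Measure.univ_pi_Ioo_ae_eq_Icc
  simpa only [hdiv, Pi.one_apply, Pi.zero_apply, hp.insertNth_one, sub_self,
    Finset.sum_const_zero, ← setIntegral_congr_set hcell] using h

theorem partialDeriv_mul (j : Fin n) {f g : (Fin n → ℝ) → ℝ} {x : Fin n → ℝ}
    (hf : DifferentiableAt ℝ f x) (hg : DifferentiableAt ℝ g x) :
    partialDeriv j (f * g) x = f x * partialDeriv j g x + partialDeriv j f x * g x := by
  simp [partialDeriv, fderiv_mul hf hg, mul_comm]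

theorem partialDeriv_comp_phase (j : Fin n) (k : Fin n → ℤ) (x : Fin n → ℝ) {f : ℝ → ℝ} {f' : ℝ}
    (hf : HasDerivAt f f' (phase k x)) :
    partialDeriv j (f ∘ phase k) x = 2 * Real.pi * k j * f' := by
  simp [partialDeriv, (hf.comp_hasFDerivAt x (phase k).hasFDerivAt).fderiv, phase_single, mul_comm]

theorem isCellPeriodic_comp_phase (k : Fin n → ℤ) {f : ℝ → ℝ}
    (hf : Function.Periodic f (2 * Real.pi)) : IsCellPeriodic (f ∘ phase k) := fun i x => by
  simpa [phase_single, mul_comm] using hf.int_mul (k i) (phase k x)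

/-- The symbol `2πi k_j` of the partial derivative `∂_j`. -/
def derivSymbol (j : Fin n) (k : Fin n → ℤ) : ℂ := (2 * Real.pi * k j : ℝ) * Complex.I

theorem conj_derivSymbol (j : Fin n) (k : Fin n → ℤ) :
    conj (derivSymbol j k) = -derivSymbol j k := by
  rw [derivSymbol, map_mul, Complex.conj_ofReal, Complex.conj_I, mul_neg]

theorem derivSymbol_neg (j : Fin n) (k : Fin n → ℤ) :
    derivSymbol j (-k) = -derivSymbol j k := by
  simp [derivSymbol]

theorem IsWeakPartial.coef_eq {j : Fin n} {u g : L2per n} (h : IsWeakPartial j u g)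
    (k : Fin n → ℤ) : coef k g = derivSymbol j k * coef k u := by
  have hcos := h _ (Real.contDiff_cos.comp (phase k).contDiff)
    (isCellPeriodic_comp_phase k Real.cos_periodic)
  have hsin := h _ (Real.contDiff_sin.comp (phase k).contDiff)
    (isCellPeriodic_comp_phase k Real.sin_periodic)
  simp only [partialDeriv_comp_phase j k _ (Real.hasDerivAt_cos _), Function.comp_apply,
    partialDeriv_comp_phase j k _ (Real.hasDerivAt_sin _), mul_left_comm (u _),
    integral_const_mul, mul_neg, integral_neg] at hcos hsin
  rw [coef_eq_integral, coef_eq_integral, derivSymbol, ← neg_inj.1 hcos,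
    ← neg_eq_iff_eq_neg.2 hsin]
  push_cast
  linear_combination (2 * Real.pi * k j * (∫ x in cell n, u x * Real.sin (phase k x) : ℝ) : ℂ)
    * Complex.I_sq

theorem IsWeakPartial.integral_eq_zero {j : Fin n} {u g : L2per n} (h : IsWeakPartial j u g) :
    ∫ x in cell n, g x = 0 := by
  have := h.coef_eq 0
  rw [coef_zero] at this
  simpa [derivSymbol] using this

theorem integral_mul_partialDeriv (j : Fin n) {f g : (Fin n → ℝ) → ℝ} (hf : ContDiff ℝ ∞ f)
    (hg : ContDiff ℝ ∞ g) (hpf : IsCellPeriodic f) (hpg : IsCellPeriodic g) :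
    ∫ x in cell n, f x * partialDeriv j g x = -∫ x in cell n, partialDeriv j f x * g x := by
  have hdiff {f : (Fin n → ℝ) → ℝ} (hf : ContDiff ℝ ∞ f) : Differentiable ℝ f :=
    hf.differentiable (by simp)
  have hint {f g : (Fin n → ℝ) → ℝ} (hf : Continuous f) (hg : Continuous g) :
      Integrable (fun x => f x * g x) (cellMeasure n) :=
    (memLp_of_continuous hf).integrable_mul (memLp_of_continuous hg)
  have h := integral_partialDeriv_eq_zero j ((hf.mul hg).of_le (by simp))
    fun i x => congrArg₂ (· * ·) (hpf i x) (hpg i x)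
  rw [eq_neg_iff_add_eq_zero, ← integral_add (hint hf.continuous (continuous_partialDeriv j hg))
    (hint (continuous_partialDeriv j hf) hg.continuous), ← h]
  exact integral_congr_ae (.of_forall fun x => (partialDeriv_mul j (hdiff hf x) (hdiff hg x)).symm)

theorem isWeakPartial_toLp (j : Fin n) {f : (Fin n → ℝ) → ℝ} (hf : ContDiff ℝ ∞ f)
    (hp : IsCellPeriodic f) :
    IsWeakPartial j (memLp_of_continuous hf.continuous).toLp
      (memLp_of_continuous (continuous_partialDeriv j hf)).toLp := fun φ hφ hpφ => by
  have hf₀ := memLp_of_continuous hf.continuous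
  have hf₁ := memLp_of_continuous (continuous_partialDeriv j hf)
  rw [integral_congr_ae (hf₀.coeFn_toLp.fun_mul (.refl _ _)),
    integral_congr_ae (hf₁.coeFn_toLp.fun_mul (.refl _ _))]
  exact integral_mul_partialDeriv j hf hφ hp hpφ

theorem isWeakPartial_iff_coef {j : Fin n} {u g : L2per n} :
    IsWeakPartial j u g ↔ ∀ k, coef k g = derivSymbol j k * coef k u := by
  refine ⟨IsWeakPartial.coef_eq, fun h φ hφ hp => ?_⟩
  have hφ' := (isWeakPartial_toLp j hφ hp).coef_eq
  rw [← inner_toLp_eq_integral_mul u (memLp_of_continuous (continuous_partialDeriv j hφ)),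
    ← inner_toLp_eq_integral_mul g (memLp_of_continuous hφ.continuous)]
  refine Complex.ofReal_injective ((hasSum_conj_coef_mul_coef _ _).unique ?_)
  rw [Complex.ofReal_neg]
  refine (hasSum_conj_coef_mul_coef _ _).neg.congr_fun fun k => ?_
  rw [hφ', h, map_mul, conj_derivSymbol]
  ring

theorem inner_weakPartial_comm {i j : Fin n} {u v ui uj vi vj : L2per n}
    (hui : IsWeakPartial i u ui) (huj : IsWeakPartial j u uj) (hvi : IsWeakPartial i v vi)
    (hvj : IsWeakPartial j v vj) : (inner ℝ ui vj : ℝ) = inner ℝ uj vi := by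
  refine Complex.ofReal_injective ((hasSum_conj_coef_mul_coef _ _).unique ?_)
  refine (hasSum_conj_coef_mul_coef _ _).congr_fun fun k => ?_
  rw [hui.coef_eq, huj.coef_eq, hvi.coef_eq, hvj.coef_eq]
  simp only [map_mul, conj_derivSymbol]
  ring

theorem IsH2per.symm {φ : L2per n} {g : Fin n → L2per n} {H : Fin n → Fin n → L2per n}
    (h : IsH2per φ g H) (i j : Fin n) : H i j = H j i :=
  ext_coef fun k => by
    rw [(h.2 i j).coef_eq, (h.2 j i).coef_eq, (h.1 i).coef_eq, (h.1 j).coef_eq, mul_left_comm]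

/-- The symbol `4π²|k|²` of `-Δ`. -/
def lapSymbol (k : Fin n → ℤ) : ℝ := ∑ j, ‖derivSymbol j k‖ ^ 2

theorem lapSymbol_neg (k : Fin n → ℤ) : lapSymbol (-k) = lapSymbol k := by
  simp [lapSymbol, derivSymbol_neg]

theorem norm_derivSymbol_sq_le (j : Fin n) (k : Fin n → ℤ) :
    ‖derivSymbol j k‖ ^ 2 ≤ lapSymbol k :=
  Finset.single_le_sum (f := fun j => ‖derivSymbol j k‖ ^ 2) (fun _ _ => sq_nonneg _)
    (Finset.mem_univ j)

theorem sum_derivSymbol_sq (k : Fin n → ℤ) : ∑ j, derivSymbol j k ^ 2 = -lapSymbol k := by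
  have h (j : Fin n) : derivSymbol j k ^ 2 = -(‖derivSymbol j k‖ : ℂ) ^ 2 := by
    rw [← Complex.conj_mul', conj_derivSymbol, neg_mul, neg_neg, sq]
  simp [lapSymbol, h]

theorem four_mul_pi_sq_le_lapSymbol {k : Fin n → ℤ} (hk : k ≠ 0) :
    4 * Real.pi ^ 2 ≤ lapSymbol k := by
  obtain ⟨j, hj⟩ := Function.ne_iff.1 hk
  have hkj : 1 ≤ (k j : ℝ) ^ 2 := by
    exact_mod_cast Int.add_one_le_iff.2 (pow_two_pos_of_ne_zero hj)
  have hnorm : ‖derivSymbol j k‖ ^ 2 = 4 * Real.pi ^ 2 * (k j : ℝ) ^ 2 := by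
    rw [derivSymbol, norm_mul, Complex.norm_I, mul_one, Complex.norm_real, Real.norm_eq_abs, sq_abs]
    ring
  exact (le_mul_of_one_le_right (by positivity) hkj).trans
    (hnorm ▸ norm_derivSymbol_sq_le j k)

theorem one_le_lapSymbol {k : Fin n → ℤ} (hk : k ≠ 0) : 1 ≤ lapSymbol k :=
  (four_mul_pi_sq_le_lapSymbol hk).trans' (by nlinarith [Real.pi_gt_three])

theorem norm_derivSymbol_le (j : Fin n) {k : Fin n → ℤ} (hk : k ≠ 0) :
    ‖derivSymbol j k‖ ≤ lapSymbol k := by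
  nlinarith [norm_derivSymbol_sq_le j k, one_le_lapSymbol hk]

theorem norm_derivSymbol_mul_le (i j : Fin n) (k : Fin n → ℤ) :
    ‖derivSymbol i k * derivSymbol j k‖ ≤ lapSymbol k := by
  rw [norm_mul]
  linarith [norm_derivSymbol_sq_le i k, norm_derivSymbol_sq_le j k,
    two_mul_le_add_sq ‖derivSymbol i k‖ ‖derivSymbol j k‖]

theorem poincare {u : L2per n} {g : Fin n → L2per n} (hg : ∀ j, IsWeakPartial j u (g j))
    (hu : ∫ x in cell n, u x = 0) : 4 * Real.pi ^ 2 * ‖u‖ ^ 2 ≤ ∑ j, ‖g j‖ ^ 2 := by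
  refine hasSum_le (fun k => ?_) ((hasSum_norm_coef_sq u).mul_left (4 * Real.pi ^ 2))
    (hasSum_sum fun j _ => hasSum_norm_coef_sq (g j))
  have hsum : ∑ j, ‖coef k (g j)‖ ^ 2 = lapSymbol k * ‖coef k u‖ ^ 2 := by
    simp only [(hg _).coef_eq, norm_mul, mul_pow, lapSymbol, Finset.sum_mul]
  rw [hsum]
  obtain rfl | hk := eq_or_ne k 0
  · simp [coef_zero, hu]
  · gcongr
    exact four_mul_pi_sq_le_lapSymbol hk

/-- `u` solves `Δu = P(D)s` up to a constant, where `P(D)` is the operator with symbol `a`. -/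
theorem exists_coef_eq_div_lapSymbol (s : L2per n) {a : (Fin n → ℤ) → ℂ}
    (ha : ∀ k ≠ 0, ‖a k‖ ≤ lapSymbol k) (hneg : ∀ k, a (-k) = conj (a k)) :
    ∃ u : L2per n, ∀ k, coef k u = -(a k / lapSymbol k) * coef k s := by
  refine exists_coef_eq_mul s (C := 1) (fun k => ?_) fun k => ?_
  · obtain rfl | hk := eq_or_ne k 0
    · simp [lapSymbol, derivSymbol]
    · have hpos := zero_lt_one.trans_le (one_le_lapSymbol hk)
      rw [norm_neg, norm_div, Complex.norm_of_nonneg hpos.le]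
      exact div_le_one_of_le₀ (ha k hk) hpos.le
  · simp [lapSymbol_neg, hneg]

theorem exists_laplacian_eq {s : L2per n} (hs : ∫ x in cell n, s x = 0) :
    ∃ (φ : L2per n) (g : Fin n → L2per n) (H : Fin n → Fin n → L2per n), IsH2per φ g H ∧
      ∑ i, H i i = s := by
  obtain ⟨φ, hφ⟩ := exists_coef_eq_div_lapSymbol s (a := 1)
    (fun k hk => by simpa using one_le_lapSymbol hk) (by simp)
  choose g hg using fun i => exists_coef_eq_div_lapSymbol s (a := derivSymbol i)
    (fun k hk => norm_derivSymbol_le i hk) fun k => by rw [derivSymbol_neg, conj_derivSymbol]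
  choose H hH using fun i j => exists_coef_eq_div_lapSymbol s
    (a := fun k => derivSymbol j k * derivSymbol i k) (fun k _ => norm_derivSymbol_mul_le j i k)
    fun k => by simp only [derivSymbol_neg, map_mul, conj_derivSymbol]
  refine ⟨φ, g, H, ⟨fun i => isWeakPartial_iff_coef.2 fun k => ?_,
    fun i j => isWeakPartial_iff_coef.2 fun k => ?_⟩, ext_coef fun k => ?_⟩
  · rw [hg, hφ, Pi.one_apply]; ring
  · rw [hH, hg]; ring
  · simp only [map_sum, hH, ← Finset.sum_mul, Finset.sum_neg_distrib, ← Finset.sum_div, ← sq,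
      sum_derivSymbol_sq]
    obtain rfl | hk := eq_or_ne k 0
    · simp [coef_zero, hs]
    · have hL : (lapSymbol k : ℂ) ≠ 0 := by
        exact_mod_cast (zero_lt_one.trans_le (one_le_lapSymbol hk)).ne'
      rw [neg_div, neg_neg, div_self hL, one_mul]

/-! ### Vector fields in `H¹_{per,0}` -/

theorem isClosed_H1perZero (n : ℕ) : IsClosed (H1perZero n : Set (L2Pair n)) := by
  have hfst (i : Fin n) (k) : Continuous fun p : L2Pair n => coef k (p.fst i) :=
    (coef k).continuous.comp ((PiLp.continuous_apply 2 _ i).comp (WithLp.continuous_fst 2 _ _))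
  have hsnd (i j : Fin n) (k) : Continuous fun p : L2Pair n => coef k (p.snd (i, j)) :=
    (coef k).continuous.comp ((PiLp.continuous_apply 2 _ (i, j)).comp (WithLp.continuous_snd 2 _ _))
  have heq : (H1perZero n : Set (L2Pair n)) = (⋂ i, {p | coef 0 (p.fst i) = 0}) ∩
      ⋂ (i) (j) (k), {p | coef k (p.snd (i, j)) = derivSymbol j k * coef k (p.fst i)} := by
    ext p
    simp [H1perZero, isWeakPartial_iff_coef, coef_zero]
  rw [heq]
  exact (isClosed_iInter fun i => isClosed_eq (hfst i 0) continuous_const).inter <|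
    isClosed_iInter fun i => isClosed_iInter fun j => isClosed_iInter fun k =>
      isClosed_eq (hsnd i j k) (continuous_const.mul (hfst i k))

instance completeSpace_H1perZero (n : ℕ) : CompleteSpace (H1perZero n) :=
  (isClosed_H1perZero n).completeSpace_coe

theorem norm_sq_eq_add_norm_jac_sq (w : H1perZero n) :
    ‖w‖ ^ 2 = ‖(w : L2Pair n).fst‖ ^ 2 + ‖jac w‖ ^ 2 :=
  WithLp.prod_norm_sq_eq_of_L2 _

/-- The constant of the Poincaré inequality `‖w‖_{H¹}² ≤ c ‖Dw‖_{L²}²` in `H¹_{per,0}(Y;ℝⁿ)`. -/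
def poincareConst : ℝ := 1 + 1 / (4 * Real.pi ^ 2)

theorem poincareConst_pos : 0 < poincareConst := by
  rw [poincareConst]; positivity

theorem norm_sq_le_poincareConst_mul (w : H1perZero n) :
    ‖w‖ ^ 2 ≤ poincareConst * ‖jac w‖ ^ 2 := by
  have hcomp : 4 * Real.pi ^ 2 * ‖(w : L2Pair n).fst‖ ^ 2 ≤ ‖jac w‖ ^ 2 := by
    rw [PiLp.norm_sq_eq_of_L2, PiLp.norm_sq_eq_of_L2, Fintype.sum_prod_type, Finset.mul_sum]
    exact Finset.sum_le_sum fun i _ => poincare (w.2.2 i) (w.2.1 i)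
  rw [norm_sq_eq_add_norm_jac_sq, poincareConst, add_comm, add_mul, one_mul, div_mul_eq_mul_div,
    one_mul]
  gcongr
  exact (le_div_iff₀' (by positivity)).2 hcomp

theorem le_sqrt_mul_of_sq_le {a b C : ℝ} (hb : 0 ≤ b) (h : a ^ 2 ≤ C * b ^ 2) : a ≤ √C * b := by
  rw [← Real.sqrt_sq hb, ← Real.sqrt_mul' _ (sq_nonneg b)]
  exact Real.le_sqrt_of_sq_le h

theorem norm_le_sqrt_poincareConst_mul (w : H1perZero n) :
    ‖w‖ ≤ √poincareConst * ‖jac w‖ :=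
  le_sqrt_mul_of_sq_le (norm_nonneg _) (norm_sq_le_poincareConst_mul w)

/-- `jac` as a continuous linear map. -/
def jacL (n : ℕ) : H1perZero n →L[ℝ] PiLp 2 fun _ : Fin n × Fin n => L2per n :=
  (WithLp.sndL 2 ℝ _ _).comp (H1perZero n).subtypeL

@[simp]
theorem jacL_apply (w : H1perZero n) : jacL n w = jac w := rfl

/-- `divg` as a continuous linear map. -/
def divgL (n : ℕ) : H1perZero n →L[ℝ] L2per n :=
  (∑ i, PiLp.proj 2 (𝕜 := ℝ) (fun _ : Fin n × Fin n => L2per n) (i, i)).comp (jacL n)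

@[simp]
theorem divgL_apply (w : H1perZero n) : divgL n w = divg w := by
  simp [divgL, divg, sum_apply]

/-- Transposition of matrix fields. -/
def transposeL (n : ℕ) : (PiLp 2 fun _ : Fin n × Fin n => L2per n) ≃ₗᵢ[ℝ]
    PiLp 2 fun _ : Fin n × Fin n => L2per n :=
  LinearIsometryEquiv.piLpCongrLeft 2 ℝ (L2per n) (Equiv.prodComm _ _)

@[simp]
theorem transposeL_apply (G : PiLp 2 fun _ : Fin n × Fin n => L2per n) (i j : Fin n) :
    transposeL n G (i, j) = G (j, i) := rfl

/-- The field `Dw - (Dw)ᵀ`, twice the skew part of the Jacobian. -/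
def skewL (n : ℕ) : H1perZero n →L[ℝ] PiLp 2 fun _ : Fin n × Fin n => L2per n :=
  jacL n - (transposeL n).toContinuousLinearEquiv.toContinuousLinearMap.comp (jacL n)

theorem skewL_apply (w : H1perZero n) : skewL n w = jac w - transposeL n (jac w) := rfl

theorem inner_jac_transpose (w : H1perZero n) :
    inner ℝ (jac w) (transposeL n (jac w)) = ‖divg w‖ ^ 2 := by
  rw [← real_inner_self_eq_norm_sq, PiLp.inner_apply, Fintype.sum_prod_type, divg, sum_inner]
  simp only [inner_sum, transposeL_apply]
  exact Finset.sum_congr rfl fun i _ => Finset.sum_congr rfl fun j _ =>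
    inner_weakPartial_comm (w.2.2 i j) (w.2.2 i i) (w.2.2 j j) (w.2.2 j i)

theorem norm_jac_sq (w : H1perZero n) :
    ‖jac w‖ ^ 2 = ‖divg w‖ ^ 2 + 1 / 2 * ‖skewL n w‖ ^ 2 := by
  rw [skewL_apply, norm_sub_sq_real, inner_jac_transpose, LinearIsometryEquiv.norm_map]
  ring

theorem norm_divg_le (w : H1perZero n) : ‖divg w‖ ≤ ‖jac w‖ := by
  refine le_of_sq_le_sq ?_ (norm_nonneg _)
  rw [norm_jac_sq]
  exact le_add_of_nonneg_right (by positivity)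

theorem norm_skewL_le (w : H1perZero n) : ‖skewL n w‖ ≤ √2 * ‖jac w‖ :=
  le_sqrt_mul_of_sq_le (norm_nonneg _) (by linarith [norm_jac_sq w, sq_nonneg ‖divg w‖])

theorem integral_divg (w : H1perZero n) : ∫ x in cell n, divg w x = 0 := by
  refine Complex.ofReal_injective ?_
  rw [← coef_zero, divg, map_sum, Complex.ofReal_zero]
  exact Finset.sum_eq_zero fun i _ => (coef_zero _).trans <| by
    exact_mod_cast (w.2.2 i i).integral_eq_zero

/-- The gradient of an `H²_per` function, as an element of `H¹_{per,0}(Y;ℝⁿ)`. -/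
def IsH2per.gradient {φ : L2per n} {g : Fin n → L2per n} {H : Fin n → Fin n → L2per n}
    (h : IsH2per φ g H) : H1perZero n :=
  ⟨WithLp.toLp 2 (WithLp.toLp 2 g, WithLp.toLp 2 fun p => H p.1 p.2),
    fun i => (h.1 i).integral_eq_zero, h.2⟩

theorem IsH2per.skewL_gradient {φ : L2per n} {g : Fin n → L2per n} {H : Fin n → Fin n → L2per n}
    (h : IsH2per φ g H) : skewL n h.gradient = 0 :=
  PiLp.ext fun p => sub_eq_zero.2 (h.symm p.1 p.2)

/-! ### The renormalized coefficients -/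

section Algebra

variable (M : Matrix (Fin n) (Fin n) ℝ) (v : Fin n → ℝ) (c : ℝ)

theorem frobSq_nonneg : 0 ≤ frobSq M :=
  Finset.sum_nonneg fun _ _ => Finset.sum_nonneg fun _ _ => sq_nonneg _

theorem euclSq_nonneg : 0 ≤ euclSq v :=
  Finset.sum_nonneg fun _ _ => sq_nonneg _

theorem frobSq_smul : frobSq (c • M) = c ^ 2 * frobSq M := by
  simp [frobSq, mul_pow, Finset.mul_sum]

theorem euclSq_smul : euclSq (c • v) = c ^ 2 * euclSq v := by
  simp [euclSq, mul_pow, Finset.mul_sum]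

theorem frobSq_sub_one : frobSq (M - 1) = frobSq M - 2 * M.trace + n := by
  have hsq (i j : Fin n) : (M - 1) i j ^ 2
      = M i j ^ 2 - 2 * (if i = j then M i j else 0) + (if i = j then 1 else 0) := by
    rw [Matrix.sub_apply, Matrix.one_apply]
    split_ifs <;> ring
  simp only [frobSq, hsq, Finset.sum_add_distrib, Finset.sum_sub_distrib, ← Finset.mul_sum]
  simp [Matrix.trace]

theorem sq_entry_le_frobSq (i j : Fin n) : M i j ^ 2 ≤ frobSq M :=
  (Finset.single_le_sum (f := fun j => M i j ^ 2) (fun _ _ => sq_nonneg _)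
    (Finset.mem_univ j)).trans (Finset.single_le_sum (f := fun i => ∑ j, M i j ^ 2)
    (fun _ _ => Finset.sum_nonneg fun _ _ => sq_nonneg _) (Finset.mem_univ i))

theorem sq_entry_le_euclSq (i : Fin n) : v i ^ 2 ≤ euclSq v :=
  Finset.single_le_sum (f := fun i => v i ^ 2) (fun _ _ => sq_nonneg _) (Finset.mem_univ i)

theorem trace_sq_le : M.trace ^ 2 ≤ n * frobSq M := by
  have hdiag : M.trace ^ 2 ≤ n * ∑ i, M i i ^ 2 := by
    simpa [Matrix.trace] using sq_sum_le_card_mul_sum_sq (s := Finset.univ) (f := fun i => M i i)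
  refine hdiag.trans ?_
  gcongr
  exact Finset.sum_le_sum fun i _ => Finset.single_le_sum (f := fun j => M i j ^ 2)
    (fun _ _ => sq_nonneg _) (Finset.mem_univ i)

theorem sum_mul_add_sum_mul_sq_le (N : Matrix (Fin n) (Fin n) ℝ) (w : Fin n → ℝ) :
    ((∑ i, ∑ j, M i j * N i j) + ∑ i, v i * w i) ^ 2
      ≤ (frobSq M + euclSq v) * (frobSq N + euclSq w) := by
  simpa [Fintype.sum_sum_type, Fintype.sum_prod_type, frobSq, euclSq] using
    Finset.sum_mul_sq_le_sq_mul_sq (Finset.univ : Finset ((Fin n × Fin n) ⊕ Fin n))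
      (Sum.elim (fun p => M p.1 p.2) v) (Sum.elim (fun p => N p.1 p.2) w)

end Algebra

section Renormalization

variable (A : (Fin n → ℝ) → Matrix (Fin n) (Fin n) ℝ) (b : (Fin n → ℝ) → Fin n → ℝ)
  (x : Fin n → ℝ)

theorem frobSq_Atil_add_euclSq_btil :
    frobSq (Atil A b x) + euclSq (btil A b x)
      = (A x).trace ^ 2 / (frobSq (A x) + euclSq (b x)) := by
  rw [Atil, btil, frobSq_smul, euclSq_smul, ← mul_add, renorm, div_pow, div_mul_eq_mul_div,
    mul_div_assoc, sq (frobSq _ + _), div_self_mul_self', div_eq_mul_inv]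

theorem frobSq_Atil_sub_one_add_euclSq_btil :
    frobSq (Atil A b x - 1) + euclSq (btil A b x)
      = n - (A x).trace ^ 2 / (frobSq (A x) + euclSq (b x)) := by
  have htrace : (Atil A b x).trace = (A x).trace ^ 2 / (frobSq (A x) + euclSq (b x)) := by
    rw [Atil, Matrix.trace_smul, renorm, smul_eq_mul]; ring
  linarith [frobSq_sub_one (Atil A b x), frobSq_Atil_add_euclSq_btil A b x]

theorem frobSq_Atil_add_euclSq_btil_le : frobSq (Atil A b x) + euclSq (btil A b x) ≤ n := by
  rw [← sub_nonneg]
  have := frobSq_Atil_sub_one_add_euclSq_btil A b x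
  have := add_nonneg (frobSq_nonneg (Atil A b x - 1)) (euclSq_nonneg (btil A b x))
  linarith [frobSq_Atil_add_euclSq_btil A b x]

variable {A b x}

theorem frobSq_Atil_sub_one_add_euclSq_btil_le {δ : ℝ} (hδ : 0 < δ) (hT : (A x).trace ≠ 0)
    (h : (frobSq (A x) + euclSq (b x)) / (A x).trace ^ 2 ≤ 1 / ((n : ℝ) - 1 + δ)) :
    frobSq (Atil A b x - 1) + euclSq (btil A b x) ≤ 1 - δ := by
  have hn : (1 : ℝ) ≤ n := by
    rw [Nat.one_le_cast, Nat.one_le_iff_ne_zero]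
    rintro rfl
    exact hT (by simp [Matrix.trace])
  have hF : 0 < frobSq (A x) + euclSq (b x) := by
    by_contra! hF
    have := trace_sq_le (A x)
    have := sq_pos_of_ne_zero hT
    nlinarith [euclSq_nonneg (b x)]
  have hTsq := sq_pos_of_ne_zero hT
  have hinv : (n : ℝ) - 1 + δ ≤ (A x).trace ^ 2 / (frobSq (A x) + euclSq (b x)) := by
    rw [div_le_div_iff₀ hTsq (by linarith)] at h
    rw [le_div_iff₀ hF]
    linarith
  linarith [frobSq_Atil_sub_one_add_euclSq_btil A b x]

end Renormalization

/-- The properties of `A`, `b` and `δ`, over the cell only, on which the renormalization argument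
rests.  The lower bound on `δ` is the one under which the sharp Poincaré inequality of the torus,
with constant `1 / (4π²)`, makes `B₂` coercive. -/
structure IsWeakCordes (A : (Fin n → ℝ) → Matrix (Fin n) (Fin n) ℝ)
    (b : (Fin n → ℝ) → Fin n → ℝ) (δ : ℝ) : Prop where
  aemeasurable_A : ∀ i j, AEMeasurable (fun x => A x i j) (cellMeasure n)
  aemeasurable_b : ∀ i, AEMeasurable (fun x => b x i) (cellMeasure n)
  trace_ne_zero : ∀ᵐ x ∂cellMeasure n, (A x).trace ≠ 0
  lt_delta : 1 / (1 + 4 * Real.pi ^ 2) < δ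
  cordes : ∀ᵐ x ∂cellMeasure n,
    (frobSq (A x) + euclSq (b x)) / (A x).trace ^ 2 ≤ 1 / ((n : ℝ) - 1 + δ)

namespace IsWeakCordes

variable {A : (Fin n → ℝ) → Matrix (Fin n) (Fin n) ℝ} {b : (Fin n → ℝ) → Fin n → ℝ} {δ : ℝ}
  (hB : IsWeakCordes A b δ)
include hB

theorem delta_pos : 0 < δ := hB.lt_delta.trans' (by positivity)

theorem aemeasurable_renorm : AEMeasurable (renorm A b) (cellMeasure n) := by
  have := hB.aemeasurable_A
  have := hB.aemeasurable_b
  unfold renorm frobSq euclSq Matrix.trace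
  simp only [Matrix.diag_apply]
  fun_prop

theorem aemeasurable_Atil (i j : Fin n) :
    AEMeasurable (fun x => Atil A b x i j) (cellMeasure n) :=
  hB.aemeasurable_renorm.mul (hB.aemeasurable_A i j)

theorem aemeasurable_btil (i : Fin n) : AEMeasurable (fun x => btil A b x i) (cellMeasure n) :=
  hB.aemeasurable_renorm.mul (hB.aemeasurable_b i)

theorem ae_frobSq_Atil_sub_one_add_le :
    ∀ᵐ x ∂cellMeasure n, frobSq (Atil A b x - 1) + euclSq (btil A b x) ≤ 1 - δ := by
  filter_upwards [hB.trace_ne_zero, hB.cordes] with x hT hx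
  exact frobSq_Atil_sub_one_add_euclSq_btil_le hB.delta_pos hT hx

end IsWeakCordes

/-! ### Zeroth-order operators with bounded coefficients -/

section Contraction

/-- The function `M : G + c · u` for `p = (u, G)`. -/
def contract (M : (Fin n → ℝ) → Matrix (Fin n) (Fin n) ℝ) (c : (Fin n → ℝ) → Fin n → ℝ)
    (p : L2Pair n) (x : Fin n → ℝ) : ℝ :=
  (∑ i, ∑ j, M x i j * p.snd (i, j) x) + ∑ i, c x i * p.fst i x

/-- The coefficients `M`, `c` are measurable and `|M|² + |c|² ≤ C` almost everywhere in the cell. -/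
structure IsCoeffBound (M : (Fin n → ℝ) → Matrix (Fin n) (Fin n) ℝ)
    (c : (Fin n → ℝ) → Fin n → ℝ) (C : ℝ) : Prop where
  aemeasurable_M : ∀ i j, AEMeasurable (fun x => M x i j) (cellMeasure n)
  aemeasurable_c : ∀ i, AEMeasurable (fun x => c x i) (cellMeasure n)
  ae_le : ∀ᵐ x ∂cellMeasure n, frobSq (M x) + euclSq (c x) ≤ C

variable {M : (Fin n → ℝ) → Matrix (Fin n) (Fin n) ℝ} {c : (Fin n → ℝ) → Fin n → ℝ} {C : ℝ}

theorem contract_add (p q : L2Pair n) :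
    contract M c (p + q) =ᵐ[cellMeasure n] contract M c p + contract M c q := by
  have hsnd : ∀ᵐ x ∂cellMeasure n, ∀ i j,
      (p + q).snd (i, j) x = p.snd (i, j) x + q.snd (i, j) x :=
    ae_all_iff.2 fun i => ae_all_iff.2 fun j => Lp.coeFn_add (p.snd (i, j)) (q.snd (i, j))
  have hfst : ∀ᵐ x ∂cellMeasure n, ∀ i, (p + q).fst i x = p.fst i x + q.fst i x :=
    ae_all_iff.2 fun i => Lp.coeFn_add (p.fst i) (q.fst i)
  filter_upwards [hsnd, hfst] with x hsnd hfst
  simp only [contract, hsnd, hfst, Pi.add_apply, mul_add, Finset.sum_add_distrib]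
  ring

theorem contract_smul (a : ℝ) (p : L2Pair n) :
    contract M c (a • p) =ᵐ[cellMeasure n] a • contract M c p := by
  have hsnd : ∀ᵐ x ∂cellMeasure n, ∀ i j, (a • p).snd (i, j) x = a * p.snd (i, j) x :=
    ae_all_iff.2 fun i => ae_all_iff.2 fun j => Lp.coeFn_smul a (p.snd (i, j))
  have hfst : ∀ᵐ x ∂cellMeasure n, ∀ i, (a • p).fst i x = a * p.fst i x :=
    ae_all_iff.2 fun i => Lp.coeFn_smul a (p.fst i)
  filter_upwards [hsnd, hfst] with x hsnd hfst
  simp only [contract, hsnd, hfst, Pi.smul_apply, smul_eq_mul, mul_add, Finset.mul_sum,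
    mul_left_comm a]

theorem integrable_frobSq_snd (p : L2Pair n) :
    Integrable (fun x => frobSq (fun i j => p.snd (i, j) x)) (cellMeasure n) :=
  integrable_finsetSum _ fun _ _ => integrable_finsetSum _ fun _ _ => (Lp.memLp _).integrable_sq

theorem integrable_euclSq_fst (p : L2Pair n) :
    Integrable (fun x => euclSq (fun i => p.fst i x)) (cellMeasure n) :=
  integrable_finsetSum _ fun _ _ => (Lp.memLp _).integrable_sq

theorem norm_sq_eq_integral (p : L2Pair n) : ‖p‖ ^ 2
    = ∫ x in cell n, frobSq (fun i j => p.snd (i, j) x) + euclSq (fun i => p.fst i x) := by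
  rw [integral_add (integrable_frobSq_snd p) (integrable_euclSq_fst p),
    WithLp.prod_norm_sq_eq_of_L2, ← real_inner_self_eq_norm_sq, ← real_inner_self_eq_norm_sq,
    inner_piLp_eq_integral_sum, inner_piLp_eq_integral_sum, add_comm]
  simp only [Fintype.sum_prod_type, frobSq, euclSq, sq]

namespace IsCoeffBound

variable (h : IsCoeffBound M c C)
include h

theorem memLp_M (i j : Fin n) : MemLp (fun x => M x i j) ∞ (cellMeasure n) := by
  refine memLp_top_of_bound (h.aemeasurable_M i j).aestronglyMeasurable √C ?_
  filter_upwards [h.ae_le] with x hx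
  exact Real.abs_le_sqrt (by linarith [sq_entry_le_frobSq (M x) i j, euclSq_nonneg (c x)])

theorem memLp_c (i : Fin n) : MemLp (fun x => c x i) ∞ (cellMeasure n) := by
  refine memLp_top_of_bound (h.aemeasurable_c i).aestronglyMeasurable √C ?_
  filter_upwards [h.ae_le] with x hx
  exact Real.abs_le_sqrt (by linarith [sq_entry_le_euclSq (c x) i, frobSq_nonneg (M x)])

theorem memLp_contract (p : L2Pair n) : MemLp (contract M c p) 2 (cellMeasure n) :=
  (memLp_finsetSum _ fun i _ => memLp_finsetSum _ fun j _ =>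
    (Lp.memLp (p.snd (i, j))).mul (h.memLp_M i j)).add
    (memLp_finsetSum _ fun i _ => (Lp.memLp (p.fst i)).mul (h.memLp_c i))

theorem norm_toLp_contract_le (p : L2Pair n) : ‖(h.memLp_contract p).toLp‖ ≤ √C * ‖p‖ := by
  refine le_sqrt_mul_of_sq_le (norm_nonneg _) ?_
  rw [← real_inner_self_eq_norm_sq, inner_eq_integral_mul, norm_sq_eq_integral,
    ← integral_const_mul]
  refine integral_mono_ae ((Lp.memLp _).integrable_mul (Lp.memLp _))
    (((integrable_frobSq_snd p).add (integrable_euclSq_fst p)).const_mul C) ?_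
  filter_upwards [(h.memLp_contract p).coeFn_toLp, h.ae_le] with x hx hle
  simp only [hx, ← sq]
  exact (sum_mul_add_sum_mul_sq_le _ _ _ _).trans <|
    mul_le_mul_of_nonneg_right hle (add_nonneg (frobSq_nonneg _) (euclSq_nonneg _))

/-- The operator `(u, G) ↦ M : G + c · u`. -/
def contractL : L2Pair n →L[ℝ] L2per n :=
  LinearMap.mkContinuous
    { toFun p := (h.memLp_contract p).toLp
      map_add' p q := by
        rw [← MemLp.toLp_add, MemLp.toLp_eq_toLp_iff]
        exact contract_add p q
      map_smul' a p := by
        rw [RingHom.id_apply, ← MemLp.toLp_const_smul, MemLp.toLp_eq_toLp_iff]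
        exact contract_smul a p }
    √C h.norm_toLp_contract_le

theorem coeFn_contractL (p : L2Pair n) : h.contractL p =ᵐ[cellMeasure n] contract M c p :=
  (h.memLp_contract p).coeFn_toLp

theorem norm_contractL_le (p : L2Pair n) : ‖h.contractL p‖ ≤ √C * ‖p‖ :=
  h.norm_toLp_contract_le p

end IsCoeffBound

end Contraction

/-! ### The form `B₂` -/

namespace IsWeakCordes

variable {A : (Fin n → ℝ) → Matrix (Fin n) (Fin n) ℝ} {b : (Fin n → ℝ) → Fin n → ℝ} {δ : ℝ}
  (hB : IsWeakCordes A b δ)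
include hB

theorem isCoeffBound : IsCoeffBound (Atil A b) (btil A b) n :=
  ⟨hB.aemeasurable_Atil, hB.aemeasurable_btil,
    .of_forall fun x => frobSq_Atil_add_euclSq_btil_le A b x⟩

theorem isCoeffBound_sub_one : IsCoeffBound (fun x => Atil A b x - 1) (btil A b) (1 - δ) :=
  ⟨fun i j => (hB.aemeasurable_Atil i j).sub_const _, hB.aemeasurable_btil,
    hB.ae_frobSq_Atil_sub_one_add_le⟩

/-- The operator `w ↦ Ã : Dw + b̃ · w`. -/
def ndL : H1perZero n →L[ℝ] L2per n := hB.isCoeffBound.contractL.comp (H1perZero n).subtypeL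

theorem norm_ndL_le (w : H1perZero n) : ‖hB.ndL w‖ ≤ √n * √poincareConst * ‖jac w‖ := by
  rw [mul_assoc]
  exact (hB.isCoeffBound.norm_contractL_le w).trans <|
    mul_le_mul_of_nonneg_left (norm_le_sqrt_poincareConst_mul w) (Real.sqrt_nonneg _)

theorem integral_mul_ndOp (r : L2per n) (w : H1perZero n) :
    ∫ x in cell n, r x * ndOp A b (fun i j => jac w (i, j)) (comp w) x
      = inner ℝ r (hB.ndL w) :=
  (inner_toLp_eq_integral_mul r (hB.isCoeffBound.memLp_contract w)).symm

theorem ndL_sub_divg (w : H1perZero n) :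
    hB.ndL w - divg w = hB.isCoeffBound_sub_one.contractL w := by
  have hdivg : divg w =ᵐ[cellMeasure n] fun x => ∑ i, jac w (i, i) x := by
    filter_upwards [Lp.coeFn_finsetSum Finset.univ fun i => jac w (i, i)] with x hx
    rw [divg, hx, Finset.sum_apply]
  refine Lp.ext ?_
  filter_upwards [Lp.coeFn_sub (hB.ndL w) (divg w), hB.isCoeffBound.coeFn_contractL w, hdivg,
    hB.isCoeffBound_sub_one.coeFn_contractL w] with x hsub hnd hdivg hone
  rw [hsub, Pi.sub_apply, hdivg, hone]
  refine (congrArg (· - _) hnd).trans ?_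
  simp only [contract, Matrix.sub_apply, sub_mul, Finset.sum_sub_distrib, Matrix.one_apply,
    ite_mul, one_mul, zero_mul, Finset.sum_ite_eq, Finset.mem_univ, if_true]
  exact add_sub_right_comm _ _ _

theorem norm_ndL_sub_divg_le (w : H1perZero n) :
    ‖hB.ndL w - divg w‖ ≤ √(poincareConst * (1 - δ)) * ‖jac w‖ := by
  rw [ndL_sub_divg, mul_comm poincareConst, Real.sqrt_mul' _ poincareConst_pos.le, mul_assoc]
  exact (hB.isCoeffBound_sub_one.norm_contractL_le w).trans <|
    mul_le_mul_of_nonneg_left (norm_le_sqrt_poincareConst_mul w) (Real.sqrt_nonneg _)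

/-- The form `B₂` as a continuous bilinear form. -/
@[irreducible]
def formL : H1perZero n →L[ℝ] H1perZero n →L[ℝ] ℝ :=
  (innerSL ℝ).bilinearComp (divgL n) hB.ndL
    + (1 / 2 : ℝ) • (innerSL ℝ).bilinearComp (skewL n) (skewL n)

theorem formL_apply (v w : H1perZero n) : hB.formL v w
    = inner ℝ (divg v) (hB.ndL w) + 1 / 2 * inner ℝ (skewL n v) (skewL n w) := by
  rw [formL, ← divgL_apply]; rfl

theorem B2_eq_formL (v w : H1perZero n) : B2 A b v w = hB.formL v w := by
  rw [B2, hB.integral_mul_ndOp, formL_apply, inner_piLp_eq_integral_sum]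
  congr 2
  refine integral_congr_ae ?_
  have hskew (u : H1perZero n) : ∀ᵐ x ∂cellMeasure n, ∀ i j,
      skewL n u (i, j) x = jac u (i, j) x - jac u (j, i) x :=
    ae_all_iff.2 fun i => ae_all_iff.2 fun j => Lp.coeFn_sub (jac u (i, j)) (jac u (j, i))
  filter_upwards [hskew v, hskew w] with x hv hw
  simp only [Fintype.sum_prod_type, hv, hw]

theorem le_formL_self (w : H1perZero n) :
    (1 - √(poincareConst * (1 - δ))) * ‖jac w‖ ^ 2 ≤ hB.formL w w := by
  have hsplit : inner ℝ (divg w) (hB.ndL w)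
      = ‖divg w‖ ^ 2 + inner ℝ (divg w) (hB.ndL w - divg w) := by
    rw [inner_sub_right, real_inner_self_eq_norm_sq, add_sub_cancel]
  have hpert : |inner ℝ (divg w) (hB.ndL w - divg w)|
      ≤ ‖jac w‖ * (√(poincareConst * (1 - δ)) * ‖jac w‖) :=
    (abs_real_inner_le_norm _ _).trans <| mul_le_mul (norm_divg_le w)
      (hB.norm_ndL_sub_divg_le w) (norm_nonneg _) (norm_nonneg _)
  rw [formL_apply, hsplit, real_inner_self_eq_norm_sq]
  linarith [norm_jac_sq w, (abs_le.1 hpert).1]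

theorem formL_le (v w : H1perZero n) :
    hB.formL v w ≤ (1 + √n * √poincareConst) * (‖jac v‖ * ‖jac w‖) := by
  have hdivg : inner ℝ (divg v) (hB.ndL w) ≤ ‖jac v‖ * (√n * √poincareConst * ‖jac w‖) :=
    (real_inner_le_norm _ _).trans <| mul_le_mul (norm_divg_le v) (hB.norm_ndL_le w)
      (norm_nonneg _) (norm_nonneg _)
  have hskew : inner ℝ (skewL n v) (skewL n w) ≤ 2 * (‖jac v‖ * ‖jac w‖) := calc
    _ ≤ √2 * ‖jac v‖ * (√2 * ‖jac w‖) := (real_inner_le_norm _ _).trans <|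
      mul_le_mul (norm_skewL_le v) (norm_skewL_le w) (norm_nonneg _) (by positivity)
    _ = _ := by rw [mul_mul_mul_comm, Real.mul_self_sqrt zero_le_two]
  rw [formL_apply]
  linarith

end IsWeakCordes

/-! ### Galerkin approximation -/

section Galerkin

theorem existsUnique_galerkin_of_isCoercive {E : Type*} [NormedAddCommGroup E]
    [InnerProductSpace ℝ E] [CompleteSpace E] {B : E →L[ℝ] E →L[ℝ] ℝ} (hB : IsCoercive B)
    (f : E →L[ℝ] ℝ) {P : Submodule ℝ E} (hP : IsClosed (P : Set E)) :
    ∃! ρ, ρ ∈ P ∧ ∀ w ∈ P, B ρ w = f w := by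
  have : CompleteSpace P := hP.completeSpace_coe
  obtain ⟨c, hc, hle⟩ := hB
  have hco : IsCoercive (B.bilinearComp P.subtypeL P.subtypeL) := ⟨c, hc, fun w => hle w⟩
  let ρ : P := hco.continuousLinearEquivOfBilin.symm
    ((InnerProductSpace.toDual ℝ P).symm (f.comp P.subtypeL))
  have hρ : ∀ w ∈ P, B ρ w = f w := fun w hw => by
    have h := hco.continuousLinearEquivOfBilin_apply ρ ⟨w, hw⟩
    rw [ContinuousLinearEquiv.apply_symm_apply, InnerProductSpace.toDual_symm_apply] at h
    exact h.symm
  refine ⟨ρ, ⟨ρ.2, hρ⟩, fun ρ' ⟨hmem, hρ'⟩ => sub_eq_zero.1 (norm_eq_zero.1 ?_)⟩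
  have hsub : ρ' - ρ ∈ P := P.sub_mem hmem ρ.2
  have hzero : B (ρ' - ρ) (ρ' - ρ) = 0 := by
    rw [ContinuousLinearMap.map_sub₂, hρ' _ hsub, hρ _ hsub, sub_self]
  have hle := hle (ρ' - ρ)
  rw [hzero, mul_assoc] at hle
  exact mul_self_eq_zero.1 (le_antisymm (nonpos_of_mul_nonpos_right hle hc) (mul_self_nonneg _))

theorem cea_le_mul_iInf {E : Type*} [AddCommGroup E] [Module ℝ E]
    {B : LinearMap.BilinForm ℝ E} {p : Seminorm ℝ E} {α M : ℝ} (hα : 0 < α) (hM : 0 ≤ M)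
    (hle : ∀ v, α * p v ^ 2 ≤ B v v) (hbdd : ∀ v w, B v w ≤ M * (p v * p w))
    {P : Submodule ℝ E} {u uh : E} (huh : uh ∈ P) (horth : ∀ w ∈ P, B (u - uh) w = 0) :
    p (u - uh) ≤ M / α * ⨅ w : P, p (u - w) := by
  rw [Real.mul_iInf_of_nonneg (by positivity)]
  refine le_ciInf fun w => ?_
  have heq : B (u - uh) (u - uh) = B (u - uh) (u - w) := by
    rw [← sub_eq_zero, ← map_sub, sub_sub_sub_cancel_left, horth _ (P.sub_mem w.2 huh)]
  rw [div_mul_eq_mul_div, le_div_iff₀' hα]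
  obtain h0 | h0 := (apply_nonneg p (u - uh)).eq_or_lt
  · rw [← h0, mul_zero]
    exact mul_nonneg hM (apply_nonneg p _)
  · refine le_of_mul_le_mul_right ?_ h0
    linarith [hle (u - uh), hbdd (u - uh) (u - w)]

end Galerkin

theorem inner_const_one (u : L2per n) :
    inner ℝ (Lp.const 2 (cellMeasure n) (1 : ℝ)) u = ∫ x in cell n, u x := by
  rw [inner_eq_integral_mul]
  refine integral_congr_ae ?_
  filter_upwards [Lp.coeFn_const (p := 2) (μ := cellMeasure n) (1 : ℝ)] with x hx
  rw [hx, Function.const_apply, one_mul]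

theorem integral_const_one (n : ℕ) :
    ∫ x in cell n, Lp.const 2 (cellMeasure n) (1 : ℝ) x = 1 := by
  rw [integral_congr_ae (Lp.coeFn_const _ _ _)]
  simp [measureReal_def, cell, Real.volume_pi_Ioo]

/-- The constant of the error bound under the assumptions of `IsWeakCordes`. -/
def ceaConst (δ : ℝ) (n : ℕ) : ℝ :=
  (1 + √n * √poincareConst) / (1 - √(poincareConst * (1 - δ)))

namespace IsWeakCordes

variable {A : (Fin n → ℝ) → Matrix (Fin n) (Fin n) ℝ} {b : (Fin n → ℝ) → Fin n → ℝ} {δ : ℝ}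
  (hB : IsWeakCordes A b δ)
include hB

theorem sqrt_lt_one : √(poincareConst * (1 - δ)) < 1 := by
  have h := hB.lt_delta
  rw [div_lt_iff₀ (by positivity)] at h
  rw [Real.sqrt_lt' one_pos, poincareConst, one_add_div (by positivity), div_mul_eq_mul_div,
    div_lt_iff₀ (by positivity)]
  linarith

theorem ceaConst_pos : 0 < ceaConst δ n :=
  div_pos (by positivity) (sub_pos.2 hB.sqrt_lt_one)

theorem isCoercive_formL : IsCoercive hB.formL := by
  refine ⟨(1 - √(poincareConst * (1 - δ))) / poincareConst,
    div_pos (sub_pos.2 hB.sqrt_lt_one) poincareConst_pos, fun w => ?_⟩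
  rw [mul_assoc, ← sq, div_mul_eq_mul_div, div_le_iff₀' poincareConst_pos]
  calc
    _ ≤ (1 - √(poincareConst * (1 - δ))) * (poincareConst * ‖jac w‖ ^ 2) :=
      mul_le_mul_of_nonneg_left (norm_sq_le_poincareConst_mul w)
        (sub_pos.2 hB.sqrt_lt_one).le
    _ = poincareConst * ((1 - √(poincareConst * (1 - δ))) * ‖jac w‖ ^ 2) := mul_left_comm _ _ _
    _ ≤ _ := mul_le_mul_of_nonneg_left (hB.le_formL_self w) poincareConst_pos.le

theorem isGalerkinSol_iff {P : Submodule ℝ (H1perZero n)} {ρ : H1perZero n} :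
    IsGalerkinSol A b P ρ ↔ ρ ∈ P ∧
      ∀ w ∈ P, hB.formL ρ w = inner ℝ (Lp.const 2 (cellMeasure n) (1 : ℝ)) (hB.ndL w) := by
  have hload (w : H1perZero n) :
      loadFun A b w = inner ℝ (Lp.const 2 (cellMeasure n) (1 : ℝ)) (hB.ndL w) := by
    rw [inner_const_one, loadFun]
    exact (integral_congr_ae (hB.isCoeffBound.coeFn_contractL w)).symm
  simp only [IsGalerkinSol, hB.B2_eq_formL, hload]

theorem existsUnique_isGalerkinSol {P : Submodule ℝ (H1perZero n)}
    (hP : IsClosed (P : Set (H1perZero n))) : ∃! ρ, IsGalerkinSol A b P ρ := by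
  let f : H1perZero n →L[ℝ] ℝ := (innerSL ℝ (Lp.const 2 (cellMeasure n) (1 : ℝ))).comp hB.ndL
  have hf (w : H1perZero n) :
      f w = inner ℝ (Lp.const 2 (cellMeasure n) (1 : ℝ)) (hB.ndL w) := rfl
  simp only [hB.isGalerkinSol_iff, ← hf]
  exact existsUnique_galerkin_of_isCoercive (E := H1perZero n) (B := hB.formL)
    hB.isCoercive_formL f hP

theorem formL_gradient (v : H1perZero n) {φ : L2per n} {g : Fin n → L2per n}
    {H : Fin n → Fin n → L2per n} (hφ : IsH2per φ g H) :
    hB.formL v hφ.gradient = inner ℝ (divg v) (hB.ndL hφ.gradient) := by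
  rw [formL_apply, hφ.skewL_gradient, inner_zero_right, mul_zero, add_zero]

theorem isRenormFPKSol_const_sub_divg {ρ : H1perZero n} (h : IsGalerkinSol A b ⊤ ρ) :
    IsRenormFPKSol A b (Lp.const 2 (cellMeasure n) (1 : ℝ) - divg ρ) := by
  rw [hB.isGalerkinSol_iff] at h
  refine ⟨fun φ g H hφ => ?_, ?_⟩
  · refine (hB.integral_mul_ndOp _ hφ.gradient).trans ?_
    rw [inner_sub_left, ← h.2 _ trivial, formL_gradient, sub_self]
  · rw [← inner_const_one, inner_sub_right, inner_const_one, inner_const_one, integral_const_one,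
      integral_divg, sub_zero]

theorem isRenormFPKSol_unique {r r' : L2per n} (h : IsRenormFPKSol A b r)
    (h' : IsRenormFPKSol A b r') : r = r' := by
  have hmean : ∫ x in cell n, (r - r' : L2per n) x = 0 := by
    rw [← inner_const_one, inner_sub_right, inner_const_one, inner_const_one, h.2, h'.2, sub_self]
  obtain ⟨φ, g, H, hφ, hlap⟩ := exists_laplacian_eq hmean
  have hdivg : divg hφ.gradient = r - r' := hlap
  have hform : hB.formL hφ.gradient hφ.gradient = 0 := by
    rw [formL_gradient, hdivg, inner_sub_left, ← hB.integral_mul_ndOp, ← hB.integral_mul_ndOp]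
    exact sub_eq_zero.2 ((h.1 φ g H hφ).trans (h'.1 φ g H hφ).symm)
  have hjac : ‖jac hφ.gradient‖ ^ 2 ≤ 0 :=
    nonpos_of_mul_nonpos_right ((hB.le_formL_self _).trans hform.le) (sub_pos.2 hB.sqrt_lt_one)
  rw [← sub_eq_zero, ← hdivg, ← norm_le_zero_iff]
  exact (norm_divg_le _).trans (by nlinarith)

theorem existsUnique_isRenormFPKSol : ∃! r, IsRenormFPKSol A b r := by
  obtain ⟨ρ, hρ, -⟩ := hB.existsUnique_isGalerkinSol (P := ⊤) isClosed_univ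
  have hr := hB.isRenormFPKSol_const_sub_divg hρ
  exact ⟨_, hr, fun r' hr' => hB.isRenormFPKSol_unique hr' hr⟩

theorem norm_jac_sub_le {P : Submodule ℝ (H1perZero n)} {ρ ρh : H1perZero n}
    (h : IsGalerkinSol A b ⊤ ρ) (hh : IsGalerkinSol A b P ρh) :
    ‖jac (ρ - ρh)‖ ≤ ceaConst δ n * ⨅ w : P, ‖jac (ρ - (w : H1perZero n))‖ := by
  rw [hB.isGalerkinSol_iff] at h hh
  refine cea_le_mul_iInf (B := hB.formL.toBilinForm)
    (p := (normSeminorm ℝ _).comp (jacL n).toLinearMap) (sub_pos.2 hB.sqrt_lt_one)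
    (by positivity) hB.le_formL_self hB.formL_le hh.1 fun w hw => ?_
  exact (ContinuousLinearMap.map_sub₂ hB.formL ρ ρh w).trans <|
    sub_eq_zero.2 ((h.2 w trivial).trans (hh.2 w hw).symm)

theorem norm_sub_const_sub_divg_le {P : Submodule ℝ (H1perZero n)} {r : L2per n}
    {ρ ρh : H1perZero n} (hr : IsRenormFPKSol A b r) (h : IsGalerkinSol A b ⊤ ρ)
    (hh : IsGalerkinSol A b P ρh) :
    ‖r - (Lp.const 2 (cellMeasure n) (1 : ℝ) - divg ρh)‖
      ≤ ceaConst δ n * ⨅ w : P, ‖jac (ρ - (w : H1perZero n))‖ := by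
  have heq : r - (Lp.const 2 (cellMeasure n) (1 : ℝ) - divg ρh) = -divg (ρ - ρh) := by
    rw [hB.isRenormFPKSol_unique hr (hB.isRenormFPKSol_const_sub_divg h), ← divgL_apply (ρ - ρh),
      map_sub, divgL_apply, divgL_apply]
    abel
  rw [heq, norm_neg]
  exact (norm_divg_le _).trans (hB.norm_jac_sub_le h hh)

end IsWeakCordes

/-! ### Specialization to the Cordes condition -/

theorem trace_pos_of_posSemidef_sub {ι : Type*} [Fintype ι] [DecidableEq ι] [Nonempty ι]
    {M : Matrix ι ι ℝ} {c : ℝ} (hc : 0 < c) (hM : (M - c • (1 : Matrix ι ι ℝ)).PosSemidef) :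
    0 < M.trace := by
  have h := hM.trace_nonneg
  rw [Matrix.trace_sub, Matrix.trace_smul, Matrix.trace_one, smul_eq_mul] at h
  have : 0 < c * Fintype.card ι := mul_pos hc (Nat.cast_pos.2 Fintype.card_pos)
  linarith

theorem one_sub_kappa (δ : ℝ) (n : ℕ) :
    1 - kappa δ n = (1 + n / Real.pi ^ 2) * (1 - δ) := by
  rw [kappa]
  have := Real.pi_pos
  have : (n : ℝ) + Real.pi ^ 2 ≠ 0 := by positivity
  field_simp
  ring

theorem poincareConst_le (hn : 0 < n) : poincareConst ≤ 1 + n / Real.pi ^ 2 := by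
  have hone : (1 : ℝ) ≤ n := Nat.one_le_cast.2 hn
  rw [poincareConst, add_le_add_iff_left]
  gcongr
  linarith [sq_nonneg Real.pi]

namespace IsCordes

variable {A : (Fin n → ℝ) → Matrix (Fin n) (Fin n) ℝ} {b : (Fin n → ℝ) → Fin n → ℝ}
  {lam Lam δ : ℝ} (hB : IsCordes A b lam Lam δ)
include hB

theorem lam_le_Lam (hn : 0 < n) : lam ≤ Lam := by
  obtain ⟨x, hlam, hLam⟩ := hB.elliptic.exists
  have h := (hLam.add hlam).diag_nonneg (i := ⟨0, hn⟩)
  simp only [Matrix.add_apply, Matrix.sub_apply, Matrix.smul_apply, Matrix.one_apply_eq,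
    smul_eq_mul, mul_one] at h
  linarith

theorem toIsWeakCordes (hn : 0 < n) : IsWeakCordes A b δ where
  aemeasurable_A i j := (hB.memLp_A i j).aestronglyMeasurable.aemeasurable.restrict
  aemeasurable_b i := (hB.memLp_b i).aestronglyMeasurable.aemeasurable.restrict
  trace_ne_zero := by
    have : Nonempty (Fin n) := ⟨⟨0, hn⟩⟩
    exact ae_restrict_of_ae <| hB.elliptic.mono fun _ h =>
      (trace_pos_of_posSemidef_sub hB.lam_pos h.1).ne'
  lt_delta := by
    refine hB.lt_delta.trans_le' ?_
    have hone : (1 : ℝ) ≤ n := Nat.one_le_cast.2 hn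
    rw [div_le_div_iff₀ (by positivity) (by positivity)]
    nlinarith [sq_nonneg Real.pi]
  cordes := ae_restrict_of_ae hB.cordes

theorem sqrt_one_sub_kappa_lt_one : √(1 - kappa δ n) < 1 := by
  have : 0 < kappa δ n := mul_pos (sub_pos.2 hB.lt_delta) (by positivity)
  rw [Real.sqrt_lt' one_pos]
  linarith

theorem ceaConst_le_errConst (hn : 0 < n) : ceaConst δ n ≤ errConst lam Lam δ n := by
  have hratio : 1 ≤ Lam / lam := (one_le_div hB.lam_pos).2 (hB.lam_le_Lam hn)
  have hnum : √n * √poincareConst ≤ Lam / lam * √n * √(1 + n / Real.pi ^ 2) :=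
    mul_le_mul (le_mul_of_one_le_left (Real.sqrt_nonneg _) hratio)
      (Real.sqrt_le_sqrt (poincareConst_le hn)) (Real.sqrt_nonneg _) (by positivity)
  have hden : √(poincareConst * (1 - δ)) ≤ √(1 - kappa δ n) := by
    rw [one_sub_kappa]
    exact Real.sqrt_le_sqrt <|
      mul_le_mul_of_nonneg_right (poincareConst_le hn) (sub_nonneg.2 hB.delta_le)
  exact div_le_div₀ (by positivity) (by linarith)
    (sub_pos.2 hB.sqrt_one_sub_kappa_lt_one) (by linarith)

end IsCordes

end FPK

end

theorem theorem2p12_general {n : ℕ} (A : (Fin n → ℝ) → Matrix (Fin n) (Fin n) ℝ)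
    (b : (Fin n → ℝ) → Fin n → ℝ) (δ : ℝ) (hB : FPK.IsWeakCordes A b δ) :
    (∃! r : FPK.L2per n, FPK.IsRenormFPKSol A b r) ∧
    (∃! ρ : FPK.H1perZero n, FPK.IsGalerkinSol A b ⊤ ρ) ∧
    0 < FPK.ceaConst δ n ∧
    ∀ (r : FPK.L2per n) (ρ : FPK.H1perZero n),
      FPK.IsRenormFPKSol A b r → FPK.IsGalerkinSol A b ⊤ ρ →
      ∀ P : Submodule ℝ (FPK.H1perZero n), IsClosed (P : Set (FPK.H1perZero n)) →
        ∃ ρh : FPK.H1perZero n, FPK.IsGalerkinSol A b P ρh ∧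
          (∀ ρ' : FPK.H1perZero n, FPK.IsGalerkinSol A b P ρ' → ρ' = ρh) ∧
          ‖r - (Lp.const 2 (FPK.cellMeasure n) (1 : ℝ) - FPK.divg ρh)‖
            ≤ FPK.ceaConst δ n * ⨅ w : P, ‖FPK.jac (ρ - (w : FPK.H1perZero n))‖ := by
  refine ⟨hB.existsUnique_isRenormFPKSol, hB.existsUnique_isGalerkinSol isClosed_univ,
    hB.ceaConst_pos, fun r ρ hr hρ P hP => ?_⟩
  obtain ⟨ρh, hρh, huniq⟩ := hB.existsUnique_isGalerkinSol hP
  exact ⟨ρh, hρh, huniq, hB.norm_sub_const_sub_divg_le hr hρ hρh⟩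

theorem theorem2p12 {n : ℕ} (hn : 0 < n)
    (A : (Fin n → ℝ) → Matrix (Fin n) (Fin n) ℝ) (b : (Fin n → ℝ) → Fin n → ℝ)
    (lam Lam δ : ℝ) (hB : FPK.IsCordes A b lam Lam δ) :
    (∃! r : FPK.L2per n, FPK.IsRenormFPKSol A b r) ∧
    (∃! ρ : FPK.H1perZero n, FPK.IsGalerkinSol A b ⊤ ρ) ∧
    0 < FPK.errConst lam Lam δ n ∧
    ∀ (r : FPK.L2per n) (ρ : FPK.H1perZero n),
      FPK.IsRenormFPKSol A b r → FPK.IsGalerkinSol A b ⊤ ρ →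
      ∀ P : Submodule ℝ (FPK.H1perZero n), IsClosed (P : Set (FPK.H1perZero n)) →
        ∃ ρh : FPK.H1perZero n, FPK.IsGalerkinSol A b P ρh ∧
          (∀ ρ' : FPK.H1perZero n, FPK.IsGalerkinSol A b P ρ' → ρ' = ρh) ∧
          ‖r - (Lp.const 2 (FPK.cellMeasure n) (1 : ℝ) - FPK.divg ρh)‖
            ≤ FPK.errConst lam Lam δ n * ⨅ w : P, ‖FPK.jac (ρ - (w : FPK.H1perZero n))‖ := by
  obtain ⟨hr, hρ, hpos, hbound⟩ := theorem2p12_general A b δ (hB.toIsWeakCordes hn)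
  have hle := hB.ceaConst_le_errConst hn
  refine ⟨hr, hρ, hpos.trans_le hle, fun r ρ hr hρ P hP => ?_⟩
  obtain ⟨ρh, hρh, huniq, hest⟩ := hbound r ρ hr hρ P hP
  exact ⟨ρh, hρh, huniq, hest.trans <|
    mul_le_mul_of_nonneg_right hle (Real.iInf_nonneg fun _ => norm_nonneg _)⟩
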